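/- **Setting.** Let $\Phi$ be a finite (reduced, crystallographic) root system with simple roots $\{\alpha_i\}_{i\in I}$, fundamental weights $\{\omega_i\}_{i\in I}$, weight lattice $\Lambda=\bigoplus_i\mathbb Z\omega_i$ and Cartan matrix $M_\Phi=(\langle\alpha_i,\alpha_j^\vee\rangle)_{i,j\in I}$. For $J\subseteq I$ let $\Phi_J$ be the root subsystem with simple roots $\{\alpha_j\}_{j\in J}$, with Weyl group $W_J$, fundamental weights $\{\omega^J_j\}_{j\in J}$, and weight lattice $\Lambda_{\Phi_J}$; let $\varrho_J=\sum_{j\in J}\omega_j^J$. Let $\Lambda^+_{\Phi_J}$ be the set of $\Phi_J$-dominant weights $\nu=\sum_{j\in J}\nu_j\omega_j^J$, $\nu_j\in\mathbb Z_{\ge0}$. For $\mu\in\Lambda_{\Phi_J}$ put $\mathcal A(e^\mu)=\sum_{w\in W_J}\det(w)e^{w\mu}$, and for $\nu\in\Lambda^+_{\Phi_J}$ let $\chi^{\Phi_J}_\nu=\mathcal A(e^{\nu+\varrho_J})/\mathcal A(e^{\varrho_J})$ be the Weyl bialternant. All posets are finite, ranked, and have the edges of their Hasse diagrams colored by $I$;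 $s\xrightarrow{i}t$ means that $t$ covers $s$ by an edge of color $i$. An $i$-component of a poset $R$ is a connected component of the graph of its edges of color $i$. For $x\in R$ let $\rho_i(x)$ be the rank of $x$ in its $i$-component, $l_i(x)$ the length of that component, $\delta_i(x)=l_i(x)-\rho_i(x)$ and $m_i(x)=\rho_i(x)-\delta_i(x)$. For $J\subseteq I$ put $wt^J(x)=\sum_{j\in J}m_j(x)\,\omega_j^J$, $wt=wt^I$, and $\mathrm{WGF}(R)|_J=\sum_{x\in R}e^{wt^J(x)}\in\mathbb Z[\Lambda_{\Phi_J}]$. For $\nu\in\Lambda_{\Phi_J}^+$ put $\mathcal M_{J,\nu}(R)=\{m\in R : \delta_j(m)\le\nu_j\text{ for all }j\in J\}$. The poset $R$ is *$M_\Phi$-structured* if $wt(s)+\alpha_i=wt(t)$ whenever $s\xrightarrow{i}t$; *fibrous* if for every $i\in I$ all its $i$-components are chains; *primary* if it is fibrous and, for all $i\ne j$ in $I$ and $x\in R$ with $l_i(x)\ge2$, $l_j(x)\ge2$ and $\delta_i(x)>0$, one has $\delta_j(x)=0$. The *crystal product* $R_1\otimes R_2$ of fibrous posets has vertex set $R_1\times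 R_2$ and an edge $(x_1,x_2)\xrightarrow{i}(y_1,y_2)$ exactly if either $x_1\xrightarrow{i}y_1$, $x_2=y_2$, $\rho_i(x_1)\ge\delta_i(x_2)$ and $\delta_i(x_1)>0$, or $x_1=y_1$, $x_2\xrightarrow{i}y_2$ and $\rho_i(x_1)<\delta_i(x_2)$; it is again (the Hasse diagram of) a fibrous poset. An $M_\Phi$-structured fibrous poset $R$ is a *crystalline splitting poset* if for every $J\subseteq I$ and $\nu\in\Lambda^+_{\Phi_J}$ there is a subset $S\subseteq R$ such that $\nu+wt^J(s)\in\Lambda^+_{\Phi_J}$ for all $s\in S$ and $\chi^{\Phi_J}_\nu\cdot\mathrm{WGF}(R)|_J=\sum_{s\in S}\chi^{\Phi_J}_{\nu+wt^J(s)}$. **Theorem 6.5.** Let $p\ge1$, let $R_1,\dots,R_p$ be $M_\Phi$-structured primary posets, and let $R$ be a disjoint sum of connected components of the crystal product $R_1\otimes\cdots\otimes R_p$. Then $R$ is a crystalline splitting poset. More precisely, for all $J\subseteq I$ and $\nu\in\Lambda^+_{\Phi_J}$ one has $\nu+wt^J(m)\in\Lambda^+_{\Phi_J}$ for all $m\in\mathcal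 M_{J,\nu}(R)$, and $$\chi^{\Phi_J}_\nu\cdot\mathrm{WGF}(R)|_J=\sum_{m\in\mathcal M_{J,\nu}(R)}\chi^{\Phi_J}_{\nu+wt^J(m)}.$$ -/

import Mathlib

universe u v

noncomputable section

/-! ### Weyl alternants and Weyl bialternants

`A : Matrix K K ℤ` is the Cartan matrix `A i j = ⟨αᵢ, αⱼ^∨⟩` of a root system with simple roots
indexed by `K`.  The weight lattice is `K → ℤ`: the function `μ` stands for `∑ i, μ i • ωᵢ`, where
`ωᵢ` are the fundamental weights, so `μ i = ⟨μ, αᵢ^∨⟩`.  The simple root `αᵢ = ∑ j, A i j • ωⱼ` is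
the row `A i`. -/

namespace WeylChar

variable {K : Type v}

/-- The Weyl group, as the group of automorphisms of the weight lattice generated by the simple
reflections `sᵢ μ = μ - ⟨μ, αᵢ^∨⟩ αᵢ`. -/
def weylGroup (A : Matrix K K ℤ) : Subgroup ((K → ℤ) ≃ₗ[ℤ] (K → ℤ)) :=
  Subgroup.closure {g | ∃ i, ∀ μ, g μ = μ - μ i • A i}

/-- The group ring `ℤ[Λ]` of the weight lattice. -/
abbrev WeightRing (K : Type v) : Type v := AddMonoidAlgebra ℤ (K → ℤ)

/-- The basis element `e^μ` of the group ring. -/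
abbrev expo (μ : K → ℤ) : WeightRing K := AddMonoidAlgebra.single μ 1

/-- The alternant `𝒜(e^μ) = ∑_{w ∈ W} det(w) e^{w μ}` (the Weyl group of a root system is finite,
see `weylGroup_finite` below). -/
def alternant (A : Matrix K K ℤ) (μ : K → ℤ) : WeightRing K :=
  ∑ᶠ w : weylGroup A, ((LinearEquiv.det (w : (K → ℤ) ≃ₗ[ℤ] (K → ℤ)) : ℤˣ) : ℤ) •
    expo ((w : (K → ℤ) ≃ₗ[ℤ] (K → ℤ)) μ)

/-- The weight `ϱ`, the sum of the fundamental weights. -/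
def rho (K : Type v) : K → ℤ := fun _ => 1

/-- Dominant weights: nonnegative integral combinations of the fundamental weights. -/
def IsDominant (μ : K → ℤ) : Prop := ∀ i, 0 ≤ μ i

/-- The field of fractions of `ℤ[Λ]`. It contains `ℤ[Λ]` and is where quotients of alternants
are formed. -/
abbrev WeightField (K : Type v) : Type v := FractionRing (WeightRing K)

/-- The inclusion of `ℤ[Λ]` in its field of fractions. -/
abbrev incl : WeightRing K →+* WeightField K := algebraMap (WeightRing K) (WeightField K)

/-- The Weyl bialternant `χ_λ = 𝒜(e^{λ+ϱ}) / 𝒜(e^ϱ)` (the denominator is nonzero for a root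
system, see `alternant_rho_ne_zero` below). -/
def bialternant (A : Matrix K K ℤ) (μ : K → ℤ) : WeightField K :=
  incl (alternant A (μ + rho K)) / incl (alternant A (rho K))

/-- For `J ⊆ I`, the projection `μ ↦ μ^J` from the weight lattice of `Φ` to the weight lattice of
the root subsystem `Φ_J`, which takes `∑_{i ∈ I} μᵢ ωᵢ` to `∑_{j ∈ J} μⱼ ωⱼ^J`. -/
def restrictWeight (J : Finset K) : (K → ℤ) →+ (J → ℤ) where
  toFun μ j := μ j
  map_zero' := rfl
  map_add' _ _ := rfl

/-- The restriction `χ ↦ χ|_J`, the ring map `ℤ[Λ] → ℤ[Λ_{Φ_J}]` with `e^μ ↦ e^{μ^J}`. -/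
def restrictChar (J : Finset K) (χ : WeightRing K) : WeightRing J :=
  AddMonoidAlgebra.mapDomain (restrictWeight J) χ

/-- The Cartan matrix of the root subsystem `Φ_J` with simple roots `αⱼ`, `j ∈ J`. -/
abbrev subCartan (A : Matrix K K ℤ) (J : Finset K) : Matrix J J ℤ :=
  A.submatrix Subtype.val Subtype.val

end WeylChar

/-! ### The Weyl groups `W_J` are finite and the denominators `𝒜(e^ϱ)` are nonzero -/

set_option linter.unusedSectionVars false

namespace WeylChar

variable {ι M N : Type*} [Finite ι] [AddCommGroup M] [Module ℝ M] [AddCommGroup N] [Module ℝ N]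
  {P : RootPairing ι ℝ M N} [P.IsRootSystem] [P.IsCrystallographic] (b : P.Base)
  (J : Finset b.support)

/-- `c` is the coordinate vector of the coroot with index `i` in the simple coroots from `J`. -/
def IsCorootCoord (c : J → ℤ) (i : ι) : Prop :=
  P.coroot i = ∑ j : J, (c j : ℝ) • P.coroot j.1

theorem repr_of_isCorootCoord {c : J → ℤ} {i : ι} (h : IsCorootCoord b J c i) (k : J) :
    b.toCoweightBasis.repr (P.coroot i) k.1 = c k := by
  classical
  rw [h]
  simp only [map_sum, map_smul, RootPairing.Base.toCoweightBasis_repr_coroot,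
    Finsupp.coe_finsetSum, Finset.sum_apply, Finsupp.coe_smul, Pi.smul_apply, smul_eq_mul]
  rw [Finset.sum_eq_single k]
  · simp
  · intro j _ hj
    rw [Finsupp.single_eq_of_ne, mul_zero]
    exact fun e => hj (Subtype.ext e.symm)
  · simp

theorem isCorootCoord_sign {c : J → ℤ} {i : ι} (h : IsCorootCoord b J c i) : 0 ≤ c ∨ c ≤ 0 := by
  have key : ∀ x ∈ AddSubmonoid.closure (P.coroot '' b.support), ∀ k,
      0 ≤ b.toCoweightBasis.repr x k := by
    intro x hx k
    induction hx using AddSubmonoid.closure_induction with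
    | mem x hx =>
      obtain ⟨j, hj, rfl⟩ := hx
      have := b.toCoweightBasis_repr_coroot ⟨j, hj⟩
      simp only at this
      rw [this]
      classical
      rw [Finsupp.single_apply]
      split_ifs <;> norm_num
    | zero => simp
    | add x y _ _ hx hy => simpa using add_nonneg hx hy
  rcases b.coroot_mem_or_neg_mem i with hi | hi
  · left
    intro k
    have := key _ hi k.1
    rw [repr_of_isCorootCoord b J h] at this
    exact_mod_cast this
  · right
    intro k
    have := key _ hi k.1
    rw [map_neg, Finsupp.neg_apply, repr_of_isCorootCoord b J h] at this
    have h' : (c k : ℝ) ≤ 0 := by linarith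
    exact_mod_cast h'

theorem isCorootCoord_single [DecidableEq J] (j : J) :
    IsCorootCoord b J (Pi.single j 1) (j.1 : ι) := by
  rw [IsCorootCoord, Finset.sum_eq_single j]
  · simp
  · intro k _ hk
    simp [Pi.single_eq_of_ne hk]
  · simp

/-- The reflection `sⱼ` on coordinates of coroots. -/
def dualRefl [DecidableEq J] (j : J) (c : J → ℤ) : J → ℤ :=
  c - Pi.single j (∑ k, subCartan b.cartanMatrix J j k * c k)

theorem isCorootCoord_dualRefl [DecidableEq J] {c : J → ℤ} {i : ι} (h : IsCorootCoord b J c i)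
    (j : J) : IsCorootCoord b J (dualRefl b J j c) (P.reflectionPerm j.1 i) := by
  have h1 : P.pairing j.1 i = ((∑ k, subCartan b.cartanMatrix J j k * c k : ℤ) : ℝ) := by
    rw [← P.root'_coroot_eq_pairing, h, map_sum]
    push_cast
    refine Finset.sum_congr rfl fun k _ => ?_
    rw [map_smul, P.root'_coroot_eq_pairing, smul_eq_mul, mul_comm]
    congr 1
    exact (b.algebraMap_cartanMatrixIn_apply ℤ j.1 k.1).symm
  rw [IsCorootCoord, P.coroot_reflectionPerm, P.coreflection_apply_coroot, h1, dualRefl]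
  generalize ∑ k, subCartan b.cartanMatrix J j k * c k = s
  simp only [Pi.sub_apply, Int.cast_sub, sub_smul, Finset.sum_sub_distrib]
  rw [← h]
  congr 1
  rw [Finset.sum_eq_single j]
  · simp
  · intro k _ hk
    simp [Pi.single_eq_of_ne hk]
  · simp

/-- The simple reflection `sⱼ` of the weight lattice. -/
def simpleRefl (j : J) : (J → ℤ) ≃ₗ[ℤ] (J → ℤ) :=
  Module.reflection (x := subCartan b.cartanMatrix J j) (f := LinearMap.proj j)
    (b.cartanMatrix_apply_same j.1)

theorem simpleRefl_apply (j : J) (μ : J → ℤ) :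
    simpleRefl b J j μ = μ - μ j • subCartan b.cartanMatrix J j := rfl

theorem simpleRefl_mul_self (j : J) : simpleRefl b J j * simpleRefl b J j = 1 := by
  ext1 μ
  exact Module.involutive_reflection (b.cartanMatrix_apply_same j.1) μ

theorem exists_word {w : (J → ℤ) ≃ₗ[ℤ] (J → ℤ)} (hw : w ∈ weylGroup (subCartan b.cartanMatrix J)) :
    ∃ L : List J, w = (L.map (simpleRefl b J)).prod := by
  have gen : ∀ g : (J → ℤ) ≃ₗ[ℤ] (J → ℤ), (∃ i, ∀ μ, g μ = μ - μ i • subCartan b.cartanMatrix J i) →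
      ∃ i, g = simpleRefl b J i := by
    rintro g ⟨i, hi⟩
    exact ⟨i, LinearEquiv.ext hi⟩
  induction hw using Subgroup.closure_induction with
  | mem g hg =>
    obtain ⟨i, rfl⟩ := gen g hg
    exact ⟨[i], by simp⟩
  | one => exact ⟨[], by simp⟩
  | mul x y _ _ hx hy =>
    obtain ⟨L, rfl⟩ := hx
    obtain ⟨L', rfl⟩ := hy
    exact ⟨L ++ L', by simp⟩
  | inv x _ hx =>
    obtain ⟨L, rfl⟩ := hx
    clear * -
    refine ⟨L.reverse, ?_⟩
    rw [inv_eq_iff_mul_eq_one]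
    induction L with
    | nil => simp
    | cons j L ih =>
      simp only [List.map_cons, List.prod_cons, List.reverse_cons, List.map_append, List.map_nil,
        List.prod_append, List.prod_nil, mul_one]
      rw [mul_assoc, ← mul_assoc _ _ (simpleRefl b J j), ih, one_mul, simpleRefl_mul_self]

theorem dot_simpleRefl [DecidableEq J] (j : J) (μ c : J → ℤ) :
    simpleRefl b J j μ ⬝ᵥ c = μ ⬝ᵥ dualRefl b J j c := by
  rw [simpleRefl_apply, dualRefl, sub_dotProduct, dotProduct_sub, smul_dotProduct,
    dotProduct_single, smul_eq_mul]
  rfl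

/-- The pairings of the root with index `i` with the simple coroots from `J`. -/
def rootWeight (i : ι) : J → ℤ := fun k => P.pairingIn ℤ i k.1

theorem simpleRefl_rootWeight (j : J) (i : ι) :
    simpleRefl b J j (rootWeight b J (P.reflectionPerm j.1 i)) = rootWeight b J i := by
  have aux (i : ι) : simpleRefl b J j (rootWeight b J i) =
      rootWeight b J (P.reflectionPerm j.1 i) := by
    ext k
    rw [simpleRefl_apply]
    simp only [Pi.sub_apply, Pi.smul_apply, smul_eq_mul, rootWeight]
    apply FaithfulSMul.algebraMap_injective ℤ ℝ
    rw [map_sub, map_mul, P.algebraMap_pairingIn, P.algebraMap_pairingIn, P.algebraMap_pairingIn]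
    have : algebraMap ℤ ℝ (subCartan b.cartanMatrix J j k) = P.pairing j.1 k.1 :=
      b.algebraMap_cartanMatrixIn_apply ℤ j.1 k.1
    rw [this, ← P.root_coroot'_eq_pairing, ← P.root_coroot'_eq_pairing _ (P.reflectionPerm j.1 i),
      P.root_reflectionPerm, P.reflection_apply_root]
    simp
  rw [aux, P.reflectionPerm_self]

/-- A word in the simple reflections acting on the coordinates of a coroot, and on its index. -/
def act [DecidableEq J] (L : List J) (p : (J → ℤ) × ι) : (J → ℤ) × ι :=
  L.foldl (fun p j => (dualRefl b J j p.1, P.reflectionPerm j.1 p.2)) p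

theorem act_spec [DecidableEq J] (L : List J) (p : (J → ℤ) × ι) (h : IsCorootCoord b J p.1 p.2) :
    IsCorootCoord b J (act b J L p).1 (act b J L p).2 ∧
      (∀ μ, (L.map (simpleRefl b J)).prod μ ⬝ᵥ p.1 = μ ⬝ᵥ (act b J L p).1) ∧
      (L.map (simpleRefl b J)).prod (rootWeight b J (act b J L p).2) = rootWeight b J p.2 := by
  induction L generalizing p with
  | nil => exact ⟨h, fun μ => rfl, rfl⟩
  | cons j L ih =>
    obtain ⟨h1, h2, h3⟩ := ih (dualRefl b J j p.1, P.reflectionPerm j.1 p.2)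
      (isCorootCoord_dualRefl b J h j)
    refine ⟨h1, fun μ => ?_, ?_⟩
    · rw [List.map_cons, List.prod_cons, LinearEquiv.mul_apply, dot_simpleRefl, h2]
      rfl
    · rw [List.map_cons, List.prod_cons, LinearEquiv.mul_apply]
      exact (congrArg _ h3).trans (simpleRefl_rootWeight b J j p.2)

/-- The Weyl group of the root subsystem `Φ_J` is finite. -/
theorem weylGroup_finite : Finite (weylGroup (subCartan b.cartanMatrix J)) := by
  classical
  have hfin : Finite {c : J → ℤ // ∃ i, IsCorootCoord b J c i} := by
    refine Finite.of_injective (β := ι) (fun c => c.2.choose) ?_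
    rintro ⟨c, hc⟩ ⟨c', hc'⟩ h
    simp only at h
    have h1 := hc.choose_spec
    have h2 := hc'.choose_spec
    rw [← h] at h2
    refine Subtype.ext (funext fun k => ?_)
    have e := (repr_of_isCorootCoord b J h1 k).symm.trans (repr_of_isCorootCoord b J h2 k)
    exact_mod_cast e
  have key (w : weylGroup (subCartan b.cartanMatrix J)) (k : J) :
      ∃ c : {c : J → ℤ // ∃ i, IsCorootCoord b J c i}, ∀ μ, w.1 μ k = μ ⬝ᵥ c.1 := by
    obtain ⟨L, hL⟩ := exists_word b J w.2
    obtain ⟨h1, h2, -⟩ := act_spec b J L (Pi.single k 1, k.1) (isCorootCoord_single b J k)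
    refine ⟨⟨_, _, h1⟩, fun μ => ?_⟩
    rw [← h2, hL, dotProduct_single, mul_one]
  choose f hf using key
  refine Finite.of_injective f fun w w' h => Subtype.ext (LinearEquiv.ext fun μ => funext fun k => ?_)
  rw [hf, hf, h]

theorem eq_single_of_dualRefl_nonpos [DecidableEq J] {c : J → ℤ} {i : ι}
    (h : IsCorootCoord b J c i) (hc : 0 ≤ c) (m : J) (hm : dualRefl b J m c ≤ 0) :
    c = Pi.single m 1 ∧ i = m.1 := by
  have h0 : ∀ k, k ≠ m → c k = 0 := fun k hk => by
    have h1 := hm k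
    simp only [dualRefl, Pi.sub_apply, Pi.single_eq_of_ne hk, sub_zero, Pi.zero_apply] at h1
    exact _root_.le_antisymm h1 (hc k)
  have h1 : P.coroot i = (c m : ℝ) • P.coroot m.1 := by
    rw [h, Finset.sum_eq_single m]
    · intro k _ hk
      simp [h0 k hk]
    · simp
  have : IsAddTorsionFree M := .of_isTorsionFree ℝ M
  have : IsAddTorsionFree N := .of_isTorsionFree ℝ N
  have h2 : c m = 1 := by
    have := b.flip.eq_one_or_neg_one_of_mem_support_of_smul_mem m.1.1 m.1.2 (c m : ℝ) ⟨i, h1⟩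
    rcases this with e | e
    · exact_mod_cast e
    · have h3 : c m = -1 := by exact_mod_cast e
      have := hc m
      rw [h3] at this
      simp at this
  refine ⟨?_, ?_⟩
  · ext k
    by_cases hk : k = m
    · subst hk
      simp [h2]
    · simp [h0 k hk, Pi.single_eq_of_ne hk]
  · rw [h2] at h1
    exact P.coroot.injective (by simpa using h1)

theorem exists_split [DecidableEq J] (L : List J) (p : (J → ℤ) × ι) (h : IsCorootCoord b J p.1 p.2)
    (hp : 0 ≤ p.1) (hL : ¬ 0 ≤ (act b J L p).1) :
    ∃ L₁ m L₂, L = L₁ ++ m :: L₂ ∧ act b J L₁ p = (Pi.single m 1, m.1.1) := by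
  induction L generalizing p with
  | nil => exact absurd hp hL
  | cons m L ih =>
    have h' := isCorootCoord_dualRefl b J h m
    rcases isCorootCoord_sign b J h' with hs | hs
    · obtain ⟨L₁, m', L₂, e, h1⟩ := ih (dualRefl b J m p.1, P.reflectionPerm m.1 p.2) h' hs hL
      exact ⟨m :: L₁, m', L₂, by rw [e]; rfl, h1⟩
    · obtain ⟨e1, e2⟩ := eq_single_of_dualRefl_nonpos b J h hp m hs
      exact ⟨[], m, L, rfl, Prod.ext e1 e2⟩

theorem eq_one_of_apply_rho (L : List J)
    (h : (L.map (simpleRefl b J)).prod (rho J) = rho J) :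
    (L.map (simpleRefl b J)).prod = 1 := by
  classical
  induction hn : L.length using Nat.strong_induction_on generalizing L with
  | _ n ih =>
  cases L with
  | nil => rfl
  | cons j L =>
    have hj := isCorootCoord_single b J j
    have h1 : simpleRefl b J j (rho J) = (L.map (simpleRefl b J)).prod (rho J) := by
      conv_lhs => rw [← h]
      rw [List.map_cons, List.prod_cons, LinearEquiv.mul_apply, ← LinearEquiv.mul_apply,
        simpleRefl_mul_self]
      rfl
    have h2 : ¬ 0 ≤ (act b J L (Pi.single j 1, j.1.1)).1 := by
      intro hc
      have e := (act_spec b J L (Pi.single j 1, j.1.1) hj).2.1 (rho J)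
      rw [← h1, simpleRefl_apply] at e
      have e1 : (rho J - rho J j • subCartan b.cartanMatrix J j) ⬝ᵥ
          (Pi.single j 1 : J → ℤ) = -1 := by
        rw [dotProduct_single, mul_one]
        simp [rho]
      have e2 : 0 ≤ rho J ⬝ᵥ (act b J L (Pi.single j 1, j.1.1)).1 :=
        Finset.sum_nonneg fun k _ => by simpa [rho] using hc k
      rw [← e, e1] at e2
      norm_num at e2
    obtain ⟨L₁, m, L₂, rfl, hs⟩ := exists_split b J L (Pi.single j 1, j.1.1) hj
      (Pi.single_nonneg.mpr zero_le_one) h2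
    obtain ⟨-, a1, a2⟩ := act_spec b J L₁ (Pi.single j 1, j.1.1) hj
    rw [hs] at a1 a2
    have comm : simpleRefl b J j * (L₁.map (simpleRefl b J)).prod =
        (L₁.map (simpleRefl b J)).prod * simpleRefl b J m := by
      ext1 μ
      rw [LinearEquiv.mul_apply, LinearEquiv.mul_apply, simpleRefl_apply, simpleRefl_apply,
        map_sub, map_smul]
      have e3 := a1 μ
      rw [dotProduct_single, dotProduct_single, mul_one, mul_one] at e3
      rw [e3]
      exact congrArg (fun v => _ - μ m • v) a2.symm
    have e4 : ((j :: (L₁ ++ m :: L₂)).map (simpleRefl b J)).prod =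
        ((L₁ ++ L₂).map (simpleRefl b J)).prod := by
      simp only [List.map_cons, List.prod_cons, List.map_append, List.prod_append]
      rw [← mul_assoc, comm, mul_assoc, ← mul_assoc (simpleRefl b J m), simpleRefl_mul_self, one_mul]
    rw [e4] at h ⊢
    refine ih _ ?_ (L₁ ++ L₂) h rfl
    simp only [List.length_cons, List.length_append] at hn ⊢
    omega

/-- The denominator `𝒜(e^ϱ)` of the bialternants for `Φ_J` is nonzero. -/
theorem alternant_rho_ne_zero : alternant (subCartan b.cartanMatrix J) (rho J) ≠ 0 := by
  classical
  have := weylGroup_finite b J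
  have := Fintype.ofFinite (weylGroup (subCartan b.cartanMatrix J))
  intro h0
  have h1 : (alternant (subCartan b.cartanMatrix J) (rho J)).coeff (rho J) = 1 := by
    rw [alternant, finsum_eq_sum_of_fintype, AddMonoidAlgebra.coeff_sum, Finsupp.finsetSum_apply, Finset.sum_eq_single 1]
    · simp
    · rintro ⟨w, hw⟩ _ hne
      obtain ⟨L, rfl⟩ := exists_word b J hw
      have : (L.map (simpleRefl b J)).prod (rho J) ≠ rho J := fun e =>
        hne (Subtype.ext (eq_one_of_apply_rho b J L e))
      simp [this]
    · simp
  rw [h0] at h1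
  simp at h1

end WeylChar

/-! ### Edge-colored ranked posets -/

/-- A finite ranked poset with edges colored by `I`, given by its colored Hasse diagram:
`Edge i s t` is the colored edge `s →ⁱ t`.  There are no multiple edges, and there is a function
`ρ` that goes up by exactly one along each edge.  This forces the reflexive transitive closure
of the edges to be a partial order whose covering relations are exactly the edges (see `le_antisymm`
and `covers_iff` below), and the poset to be ranked. -/
structure ColoredRankedPoset (I : Type v) where
  /-- the vertices -/
  V : Type u
  finite : Finite V
  /-- the colored edges of the Hasse diagram -/
  Edge : I → V → V → Prop
  color_unique : ∀ i j s t, Edge i s t → Edge j s t → i = j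
  ranked : ∃ ρ : V → ℕ, ∀ i s t, Edge i s t → ρ t = ρ s + 1

namespace ColoredRankedPoset

open WeylChar

variable {I : Type v} (R : ColoredRankedPoset.{u, v} I)

instance : Finite R.V := R.finite

/-- The partial order with the given Hasse diagram. -/
def le : R.V → R.V → Prop := Relation.ReflTransGen fun s t => ∃ i, R.Edge i s t

/-- A function on `R` that goes up by one along each edge. -/
def rk : R.V → ℕ := R.ranked.choose

theorem rk_edge {i : I} {s t : R.V} (h : R.Edge i s t) : R.rk t = R.rk s + 1 :=
  R.ranked.choose_spec i s t h

theorem eq_or_rk_lt_of_le {s t : R.V} (h : R.le s t) : s = t ∨ R.rk s < R.rk t := by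
  induction h with
  | refl => exact Or.inl rfl
  | tail _ hbc ih =>
    obtain ⟨i, hi⟩ := hbc
    have := R.rk_edge hi
    rcases ih with rfl | ih <;> right <;> omega

theorem le_antisymm {s t : R.V} (h₁ : R.le s t) (h₂ : R.le t s) : s = t := by
  rcases R.eq_or_rk_lt_of_le h₁ with h | h
  · exact h
  · rcases R.eq_or_rk_lt_of_le h₂ with h' | h'
    · exact h'.symm
    · omega

theorem covers_iff (s t : R.V) :
    (∃ i, R.Edge i s t) ↔
      R.le s t ∧ s ≠ t ∧ ∀ x, R.le s x → R.le x t → s = x ∨ x = t := by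
  constructor
  · rintro ⟨i, hi⟩
    have h := R.rk_edge hi
    refine ⟨Relation.ReflTransGen.single ⟨i, hi⟩, ?_, ?_⟩
    · rintro rfl
      omega
    · intro x hx hx'
      rcases R.eq_or_rk_lt_of_le hx with h1 | h1
      · exact Or.inl h1
      · rcases R.eq_or_rk_lt_of_le hx' with h2 | h2
        · exact Or.inr h2
        · omega
  · rintro ⟨hle, hne, hcov⟩
    rcases Relation.ReflTransGen.cases_head hle with h | ⟨x, hx, hxt⟩
    · exact absurd h hne
    · rcases hcov x (Relation.ReflTransGen.single hx) hxt with h | h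
      · obtain ⟨i, hi⟩ := hx
        have := R.rk_edge hi
        rw [h] at this
        omega
      · rwa [← h]

/-- The `J`-component of `x`: the connected component of `x` after all edges whose color is not in
`J` are removed. -/
def comp (J : Set I) (x : R.V) : Set R.V :=
  {y | Relation.EqvGen (fun s t => ∃ j ∈ J, R.Edge j s t) x y}

/-- `ρᵢ(x)`: the rank of `x` within its `i`-component. -/
def rankIn (i : I) (x : R.V) : ℕ := R.rk x - sInf (R.rk '' R.comp {i} x)

/-- `lᵢ(x)`: the length of the `i`-component of `x`. -/
def lengthIn (i : I) (x : R.V) : ℕ := sSup (R.rk '' R.comp {i} x) - sInf (R.rk '' R.comp {i} x)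

/-- `δᵢ(x) = lᵢ(x) - ρᵢ(x)`. -/
def depthIn (i : I) (x : R.V) : ℕ := R.lengthIn i x - R.rankIn i x

/-- The weight `wt(x) = ∑ i, mᵢ(x) ωᵢ`, where `mᵢ(x) = 2 ρᵢ(x) - lᵢ(x)`. -/
def wt (x : R.V) : I → ℤ := fun i => 2 * (R.rankIn i x : ℤ) - (R.lengthIn i x : ℤ)

/-- The `J`-weight `wt^J(x)`. -/
def wtRes (J : Finset I) (x : R.V) : J → ℤ := restrictWeight J (R.wt x)

/-- The weight generating function `WGF(R) = ∑_{x ∈ R} e^{wt(x)}`. -/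
def wgf : WeightRing I := ∑ᶠ x : R.V, expo (R.wt x)

/-- `R` is fibrous: for each color `i`, all `i`-components are chains. -/
def IsFibrous : Prop :=
  ∀ (i : I) (x y z : R.V), y ∈ R.comp {i} x → z ∈ R.comp {i} x →
    Relation.ReflTransGen (R.Edge i) y z ∨ Relation.ReflTransGen (R.Edge i) z y

/-- `R` is primary: it is fibrous, and whenever `x` lies on an `i`-component and on a `j`-component,
`i ≠ j`, both of length at least two, and `x` is not the top of the `i`-component, it is the top of
the `j`-component. -/
def IsPrimary : Prop :=
  R.IsFibrous ∧ ∀ (i j : I) (x : R.V), j ≠ i → 2 ≤ R.lengthIn i x → R.depthIn i x ≠ 0 →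
    2 ≤ R.lengthIn j x → R.depthIn j x = 0

/-- `R` is structured by the Cartan matrix `A`: `wt(s) + αᵢ = wt(t)` whenever `s →ⁱ t`. -/
def IsStructured (A : Matrix I I ℤ) : Prop :=
  ∀ (i : I) (s t : R.V), R.Edge i s t → R.wt s + A i = R.wt t

/-- The crystal product `R₁ ⊗ R₂`. -/
def crystalProduct (R₁ R₂ : ColoredRankedPoset.{u, v} I) : ColoredRankedPoset.{u, v} I where
  V := R₁.V × R₂.V
  finite := inferInstance
  Edge i x y :=
    (R₁.Edge i x.1 y.1 ∧ x.2 = y.2 ∧ R₂.depthIn i x.2 ≤ R₁.rankIn i x.1 ∧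
        0 < R₁.depthIn i x.1) ∨
      (x.1 = y.1 ∧ R₂.Edge i x.2 y.2 ∧ R₁.rankIn i x.1 < R₂.depthIn i x.2)
  color_unique := by
    have irr (R : ColoredRankedPoset.{u, v} I) (i : I) (s t : R.V) (h : R.Edge i s t) :
        s ≠ t := by
      rintro rfl
      have := R.rk_edge h
      omega
    rintro i j s t (⟨h, h', -⟩ | ⟨h, h', -⟩) (⟨k, k', -⟩ | ⟨k, k', -⟩)
    · exact R₁.color_unique i j _ _ h k
    · exact absurd k (irr _ _ _ _ h)
    · exact absurd h (irr _ _ _ _ k)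
    · exact R₂.color_unique i j _ _ h' k'
  ranked := by
    refine ⟨fun x => R₁.rk x.1 + R₂.rk x.2, ?_⟩
    rintro i s t (⟨h, h', -⟩ | ⟨h, h', -⟩)
    · have := R₁.rk_edge h
      simp only [h', this]
      omega
    · have := R₂.rk_edge h'
      simp only [h, this]
      omega

/-- The iterated crystal product `R₁ ⊗ R₂ ⊗ ⋯ ⊗ R_p`, where `p ≥ 1` and `Rs = [R₂, …, R_p]`,
formed as `(⋯(R₁ ⊗ R₂) ⊗ ⋯) ⊗ R_p`. -/
def crystalProductList (R₁ : ColoredRankedPoset.{u, v} I)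
    (Rs : List (ColoredRankedPoset.{u, v} I)) : ColoredRankedPoset.{u, v} I :=
  Rs.foldl crystalProduct R₁

/-- A set of vertices is a union of connected components. -/
def IsUnionOfComponents (U : Set R.V) : Prop := ∀ x ∈ U, R.comp Set.univ x ⊆ U

/-- The poset carried by a set `U` of vertices, with the edges of `R` between them. If `U` is a
union of connected components of `R`, this is the disjoint sum of these components. -/
def restrict (U : Set R.V) : ColoredRankedPoset.{u, v} I where
  V := U
  finite := inferInstance
  Edge i s t := R.Edge i s t
  color_unique i j s t := R.color_unique i j s t
  ranked := ⟨fun x => R.rk x, fun _ _ _ h => R.rk_edge h⟩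

/-- `ℳ_{J,ν}(R) = {m ∈ R | δⱼ(m) ≤ νⱼ for all j ∈ J}`. -/
def maxSet (J : Finset I) (ν : J → ℤ) : Set R.V := {m | ∀ j : J, (R.depthIn j m : ℤ) ≤ ν j}

/-- `R`, together with the set `S` of vertices, is a `(J,ν)`-splitting poset, for the root system
with Cartan matrix `A`: `R` is structured by `A`, all the weights `ν + wt^J(s)` with `s ∈ S` are
dominant for `Φ_J`, and `χ_ν · WGF(R)|_J = ∑_{s ∈ S} χ_{ν + wt^J(s)}`, with bialternants for
`Φ_J`. -/
def IsSplitting (A : Matrix I I ℤ) (J : Finset I) (ν : J → ℤ) (S : Set R.V) : Prop :=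
  R.IsStructured A ∧
  (∀ s ∈ S, IsDominant (ν + R.wtRes J s)) ∧
  bialternant (subCartan A J) ν * incl (restrictChar J R.wgf) =
    ∑ᶠ s ∈ S, bialternant (subCartan A J) (ν + R.wtRes J s)

/-- `R` is a crystalline splitting poset for the root system with Cartan matrix `A`. -/
def IsCrystallineSplitting (A : Matrix I I ℤ) : Prop :=
  R.IsStructured A ∧ R.IsFibrous ∧
    ∀ (J : Finset I) (ν : J → ℤ), IsDominant ν → ∃ S : Set R.V, R.IsSplitting A J ν S

end ColoredRankedPoset

end

/-!
The proof is an involution argument. The weight generating function of a fibrous structured poset is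
invariant under `W_J`, because a simple reflection turns the strings (the components of one color)
upside down (`IsStructured.exists_equiv`). Hence `𝒜(e^{ν+ϱ}) · WGF(R)|_J` is the sum of the
alternants `𝒜(e^{ν+ϱ+wt(x)})` over all `x ∈ R` (`alternant_mul_sum_expo`), and it remains to cancel
the terms with `x ∉ ℳ_{J,ν}(R)`.

If `δⱼ(x) > νⱼ`, then the string of `x` of color `j` contains exactly one vertex `y` with
`ν + ϱ + wt(y) = sⱼ(ν + ϱ + wt(x))`, and again `δⱼ(y) > νⱼ`. So `x ↦ y` is a sign-reversing
involution as soon as the color `j` can be chosen consistently for `x` and for `y`. Such a choice is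
called a violation coloring below (`IsViolationColoring`, `sum_alternant_eq_zero`). As the involution
does not leave the string, it preserves connected components.

In a primary poset a violation `δⱼ(x) > νⱼ` on a string of length at least two occurs for at most one
color `j`, and a violation on a string of length one occurs only if `νⱼ = 0` and `x` is the bottom of
the string, in which case `y = x`. This gives violation colorings of primary posets. In a product
`R₁ ⊗ R₂` one has `δⱼ(x₁, x₂) = max (δⱼ(x₁)) (δⱼ(x₂) - mⱼ(x₁))`, so `(x₁, x₂)` lies in `ℳ_{J,ν}` exactly
if `x₁ ∈ ℳ_{J,ν}(R₁)` and `x₂ ∈ ℳ_{J,ν+wt(x₁)}(R₂)`. The first factor at which this fails supplies the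
color (`IsViolationColoring.crystalProduct`): along the part `δⱼ > νⱼ` of a string, either `x₁`
violates the bound throughout, or `x₁` does not move at all.
-/

noncomputable section

namespace ColoredRankedPoset

open WeylChar Relation

variable {I : Type v} (R : ColoredRankedPoset.{u, v} I)

/-! ### Strings -/

/-- The edges of color `i` form strings (disjoint chains), and `r` and `d` are the numbers of steps
down and up that are left in the string of a vertex. -/
structure HasStrings (i : I) (r d : R.V → ℕ) : Prop where
  right_unique : ∀ {s t t'}, R.Edge i s t → R.Edge i s t' → t = t'
  left_unique : ∀ {s s' t}, R.Edge i s t → R.Edge i s' t → s = s'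
  rank_edge : ∀ {s t}, R.Edge i s t → r t = r s + 1
  depth_edge : ∀ {s t}, R.Edge i s t → d s = d t + 1
  exists_up : ∀ {s}, 0 < d s → ∃ t, R.Edge i s t
  exists_down : ∀ {t}, 0 < r t → ∃ s, R.Edge i s t

variable {R} {i : I} {r d : R.V → ℕ}

theorem mem_comp_singleton {x y : R.V} : y ∈ R.comp {i} x ↔ EqvGen (R.Edge i) x y := by
  simp [comp]

theorem eq_or_rk_lt_of_reflTransGen {x y : R.V} (h : ReflTransGen (R.Edge i) x y) :
    x = y ∨ R.rk x < R.rk y :=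
  R.eq_or_rk_lt_of_le (ReflTransGen.mono (fun _ _ e => ⟨i, e⟩) _ _ h)

theorem eq_of_reflTransGen_of_rk {x y : R.V} (h : ReflTransGen (R.Edge i) x y)
    (hr : R.rk y ≤ R.rk x) : x = y :=
  (eq_or_rk_lt_of_reflTransGen h).resolve_right (by omega)

namespace HasStrings

variable (h : R.HasStrings i r d)
include h

/-- A string is a chain: determinism of the edges in both directions makes any two of its vertices
comparable. -/
theorem comparable {x y : R.V} (hxy : EqvGen (R.Edge i) x y) :
    ReflTransGen (R.Edge i) x y ∨ ReflTransGen (R.Edge i) y x := by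
  induction hxy with
  | rel _ _ e => exact .inl (.single e)
  | refl => exact .inl .refl
  | symm _ _ _ ih => exact ih.symm
  | trans a b c _ _ h₁ h₂ =>
    rcases h₁ with h₁ | h₁ <;> rcases h₂ with h₂ | h₂
    · exact .inl (h₁.trans h₂)
    · have := ReflTransGen.total_of_right_unique (r := Function.swap (R.Edge i))
        (fun _ _ _ e e' => h.left_unique e e') (reflTransGen_swap.2 h₁) (reflTransGen_swap.2 h₂)
      exact this.symm.imp reflTransGen_swap.1 reflTransGen_swap.1
    · exact ReflTransGen.total_of_right_unique (fun _ _ _ e e' => h.right_unique e e') h₁ h₂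
    · exact .inr (h₂.trans h₁)

theorem invariants {x y : R.V} (hxy : EqvGen (R.Edge i) x y) :
    r x + d x = r y + d y ∧ R.rk x + d x = R.rk y + d y := by
  induction hxy with
  | rel _ _ e =>
    have := h.rank_edge e
    have := h.depth_edge e
    have := R.rk_edge e
    omega
  | refl => exact ⟨rfl, rfl⟩
  | symm _ _ _ ih => exact ⟨ih.1.symm, ih.2.symm⟩
  | trans _ _ _ _ _ h₁ h₂ => exact ⟨h₁.1.trans h₂.1, h₁.2.trans h₂.2⟩

theorem eq_of_depth {x y : R.V} (hxy : EqvGen (R.Edge i) x y) (hd : d x = d y) : x = y := by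
  have := (h.invariants hxy).2
  rcases h.comparable hxy with e | e
  · exact eq_of_reflTransGen_of_rk e (by omega)
  · exact (eq_of_reflTransGen_of_rk e (by omega)).symm

/-- A string has a vertex at each depth between `0` and its length. -/
theorem exists_depth (x : R.V) {n : ℕ} (hn : n ≤ r x + d x) :
    ∃ y, EqvGen (R.Edge i) x y ∧ d y = n := by
  rcases le_total n (d x) with hle | hle
  · induction hle using Nat.decreasingInduction with
    | self => exact ⟨x, .refl _, rfl⟩
    | of_succ k hk ih =>
      obtain ⟨y, hy, e⟩ := ih (by omega)
      obtain ⟨z, hz⟩ := h.exists_up (s := y) (by omega)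
      have := h.depth_edge hz
      exact ⟨z, hy.trans _ _ _ (.rel _ _ hz), by omega⟩
  · induction n, hle using Nat.le_induction with
    | base => exact ⟨x, .refl _, rfl⟩
    | succ k hk ih =>
      obtain ⟨y, hy, e⟩ := ih (by omega)
      have := (h.invariants hy).1
      obtain ⟨z, hz⟩ := h.exists_down (t := y) (by omega)
      have := h.depth_edge hz
      exact ⟨z, hy.trans _ _ _ (.symm _ _ (.rel _ _ hz)), by omega⟩

theorem rank_le_rk (x : R.V) : r x ≤ R.rk x := by
  obtain ⟨y, hy, e⟩ := h.exists_depth x (n := r x + d x) le_rfl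
  have := (h.invariants hy)
  omega

theorem sInf_rk (x : R.V) : sInf (R.rk '' R.comp {i} x) = R.rk x - r x := by
  have := h.rank_le_rk x
  refine IsLeast.csInf_eq ⟨?_, ?_⟩
  · obtain ⟨y, hy, e⟩ := h.exists_depth x (n := r x + d x) le_rfl
    have := (h.invariants hy)
    exact ⟨y, mem_comp_singleton.2 hy, by omega⟩
  · rintro _ ⟨y, hy, rfl⟩
    have := (h.invariants (mem_comp_singleton.1 hy))
    omega

theorem sSup_rk (x : R.V) : sSup (R.rk '' R.comp {i} x) = R.rk x + d x := by
  refine IsGreatest.csSup_eq ⟨?_, ?_⟩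
  · obtain ⟨y, hy, e⟩ := h.exists_depth x (n := 0) (Nat.zero_le _)
    have := (h.invariants hy)
    exact ⟨y, mem_comp_singleton.2 hy, by omega⟩
  · rintro _ ⟨y, hy, rfl⟩
    have := (h.invariants (mem_comp_singleton.1 hy))
    omega

theorem rankIn_eq : R.rankIn i = r := by
  ext x
  have := h.rank_le_rk x
  rw [rankIn, h.sInf_rk]
  omega

theorem lengthIn_eq (x : R.V) : R.lengthIn i x = r x + d x := by
  have := h.rank_le_rk x
  rw [lengthIn, h.sInf_rk, h.sSup_rk]
  omega

theorem depthIn_eq : R.depthIn i = d := by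
  ext x
  rw [depthIn, h.lengthIn_eq, h.rankIn_eq]
  omega

theorem wt_apply (x : R.V) : R.wt x i = r x - d x := by
  rw [wt, h.rankIn_eq, h.lengthIn_eq]
  push_cast
  ring

end HasStrings

theorem isFibrous_of_hasStrings (h : ∀ i, ∃ r d, R.HasStrings i r d) : R.IsFibrous := by
  intro i x y z hy hz
  obtain ⟨r, d, h⟩ := h i
  exact h.comparable (((mem_comp_singleton.1 hy).symm).trans _ _ _ (mem_comp_singleton.1 hz))

theorem comp_eq_of_eqvGen {x y : R.V} (hxy : EqvGen (R.Edge i) x y) :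
    R.comp {i} x = R.comp {i} y := by
  ext z
  rw [mem_comp_singleton, mem_comp_singleton]
  exact ⟨hxy.symm.trans _ _ _, hxy.trans _ _ _⟩

/-- Together with `isFibrous_of_hasStrings`, this replaces the global definitions of `ρᵢ` and `δᵢ` by
local conditions on edges. -/
theorem IsFibrous.hasStrings (h : R.IsFibrous) (i : I) :
    R.HasStrings i (R.rankIn i) (R.depthIn i) := by
  have hne (x : R.V) : (R.rk '' R.comp {i} x).Nonempty :=
    ⟨_, x, mem_comp_singleton.2 (.refl x), rfl⟩
  have hbdd (x : R.V) : BddAbove (R.rk '' R.comp {i} x) := (Set.toFinite _).bddAbove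
  have hlow {x y : R.V} (hxy : EqvGen (R.Edge i) x y) : sInf (R.rk '' R.comp {i} x) ≤ R.rk y :=
    Nat.sInf_le ⟨y, mem_comp_singleton.2 hxy, rfl⟩
  have hupp {x y : R.V} (hxy : EqvGen (R.Edge i) x y) : R.rk y ≤ sSup (R.rk '' R.comp {i} x) :=
    le_csSup (hbdd x) ⟨y, mem_comp_singleton.2 hxy, rfl⟩
  have cmp {x y : R.V} (hxy : EqvGen (R.Edge i) x y) :
      ReflTransGen (R.Edge i) x y ∨ ReflTransGen (R.Edge i) y x :=
    h i x x y (mem_comp_singleton.2 (.refl x)) (mem_comp_singleton.2 hxy)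
  have eq {x y : R.V} (hxy : EqvGen (R.Edge i) x y) (e : R.rk x = R.rk y) : x = y := by
    rcases cmp hxy with c | c
    · exact eq_of_reflTransGen_of_rk c e.ge
    · exact (eq_of_reflTransGen_of_rk c e.le).symm
  constructor
  · intro s t t' e e'
    exact eq ((EqvGen.rel _ _ e).symm.trans _ _ _ (.rel _ _ e'))
      ((R.rk_edge e).trans (R.rk_edge e').symm)
  · intro s s' t e e'
    have := R.rk_edge e
    have := R.rk_edge e'
    exact eq ((EqvGen.rel _ _ e).trans _ _ _ (.symm _ _ (.rel _ _ e'))) (by omega)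
  · intro s t e
    have := hlow (.refl s)
    have := R.rk_edge e
    rw [rankIn, rankIn, ← comp_eq_of_eqvGen (.rel _ _ e)]
    omega
  · intro s t e
    have := hlow (.refl s)
    have := hupp (.rel _ _ e)
    have := R.rk_edge e
    rw [depthIn, depthIn, lengthIn, lengthIn, rankIn, rankIn, ← comp_eq_of_eqvGen (.rel _ _ e)]
    omega
  · intro s hs
    obtain ⟨y, hy, e⟩ := Nat.sSup_mem (hne s) (hbdd s)
    rw [mem_comp_singleton] at hy
    rw [depthIn, lengthIn, rankIn, ← e] at hs
    rcases cmp hy with c | c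
    · rcases c.cases_head with rfl | ⟨t, ht, -⟩
      · omega
      · exact ⟨t, ht⟩
    · rcases eq_or_rk_lt_of_reflTransGen c with rfl | hlt <;> omega
  · intro s hs
    obtain ⟨y, hy, e⟩ := Nat.sInf_mem (hne s)
    rw [mem_comp_singleton] at hy
    rw [rankIn, ← e] at hs
    rcases cmp hy with c | c
    · rcases eq_or_rk_lt_of_reflTransGen c with rfl | hlt <;> omega
    · rcases c.cases_tail with rfl | ⟨t, -, ht⟩
      · omega
      · exact ⟨t, ht⟩

/-- Along a string of color `i`, the weight changes by multiples of the simple root `αᵢ`. -/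
theorem IsStructured.wt_eq {A : Matrix I I ℤ} (hA : R.IsStructured A) (h : R.HasStrings i r d)
    {x y : R.V} (hxy : EqvGen (R.Edge i) x y) : R.wt y = R.wt x + ((d x : ℤ) - d y) • A i := by
  induction hxy with
  | rel _ _ e =>
    rw [← hA i _ _ e, h.depth_edge e]
    simp
  | refl => simp
  | symm _ _ _ ih =>
    rw [ih, add_assoc, ← add_smul]
    simp
  | trans _ _ _ _ _ h₁ h₂ =>
    rw [h₂, h₁, add_assoc, ← add_smul]
    congr 2
    ring

/-! ### Crystal products and sums of components -/

/-- In a string of the product, read upwards, `x₂` rises until `δᵢ(x₂) = ρᵢ(x₁)` and then `x₁` rises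
to its top. The subtractions in `ℕ` are truncated on purpose: they are positive parts. -/
theorem HasStrings.crystalProduct {R₁ R₂ : ColoredRankedPoset.{u, v} I} {r₁ d₁ : R₁.V → ℕ}
    {r₂ d₂ : R₂.V → ℕ} (h₁ : R₁.HasStrings i r₁ d₁) (h₂ : R₂.HasStrings i r₂ d₂) :
    (crystalProduct R₁ R₂).HasStrings i (fun x => r₂ x.2 + (r₁ x.1 - d₂ x.2))
      (fun x => d₁ x.1 + (d₂ x.2 - r₁ x.1)) := by
  have edge (x y : R₁.V × R₂.V) : (R₁.crystalProduct R₂).Edge i x y ↔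
      (R₁.Edge i x.1 y.1 ∧ x.2 = y.2 ∧ d₂ x.2 ≤ r₁ x.1 ∧ 0 < d₁ x.1) ∨
      (x.1 = y.1 ∧ R₂.Edge i x.2 y.2 ∧ r₁ x.1 < d₂ x.2) := by
    simp only [ColoredRankedPoset.crystalProduct, h₁.rankIn_eq, h₁.depthIn_eq, h₂.depthIn_eq]
  constructor
  · rintro ⟨s, s'⟩ ⟨t, t'⟩ ⟨u, u'⟩ e e'
    rw [edge] at e e'
    rcases e with ⟨e1, rfl, e2⟩ | ⟨rfl, e1, e2⟩ <;> rcases e' with ⟨e1', rfl, e2'⟩ | ⟨rfl, e1', e2'⟩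
    · exact Prod.ext (h₁.right_unique e1 e1') rfl
    · simp only at *
      omega
    · simp only at *
      omega
    · exact Prod.ext rfl (h₂.right_unique e1 e1')
  · rintro ⟨s, s'⟩ ⟨u, u'⟩ ⟨t, t'⟩ e e'
    rw [edge] at e e'
    rcases e with ⟨e1, e3, e2⟩ | ⟨e3, e1, e2⟩ <;> rcases e' with ⟨e1', e3', e2'⟩ | ⟨e3', e1', e2'⟩ <;>
      simp only at e1 e2 e3 e1' e2' e3' <;> subst e3 <;> subst e3'
    · exact Prod.ext (h₁.left_unique e1 e1') rfl
    · have := h₁.rank_edge e1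
      have := h₂.depth_edge e1'
      omega
    · have := h₁.rank_edge e1'
      have := h₂.depth_edge e1
      omega
    · exact Prod.ext rfl (h₂.left_unique e1 e1')
  · rintro ⟨s, s'⟩ ⟨t, t'⟩ e
    rw [edge] at e
    rcases e with ⟨e1, e3, e2⟩ | ⟨e3, e1, e2⟩ <;> simp only at e1 e2 e3 ⊢ <;> subst e3
    · have := h₁.rank_edge e1
      omega
    · have := h₂.rank_edge e1
      have := h₂.depth_edge e1
      omega
  · rintro ⟨s, s'⟩ ⟨t, t'⟩ e
    rw [edge] at e
    rcases e with ⟨e1, e3, e2⟩ | ⟨e3, e1, e2⟩ <;> simp only at e1 e2 e3 ⊢ <;> subst e3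
    · have := h₁.rank_edge e1
      have := h₁.depth_edge e1
      omega
    · have := h₂.depth_edge e1
      omega
  · rintro ⟨s, s'⟩ hs
    simp only at hs
    rcases le_or_gt (d₂ s') (r₁ s) with hle | hlt
    · obtain ⟨t, ht⟩ := h₁.exists_up (s := s) (by omega)
      exact ⟨(t, s'), (edge _ _).2 (.inl ⟨ht, rfl, hle, by simp only; omega⟩)⟩
    · obtain ⟨t, ht⟩ := h₂.exists_up (s := s') (by omega)
      exact ⟨(s, t), (edge _ _).2 (.inr ⟨rfl, ht, hlt⟩)⟩
  · rintro ⟨t, t'⟩ ht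
    simp only at ht
    rcases le_or_gt (r₁ t) (d₂ t') with hle | hlt
    · obtain ⟨s, hs⟩ := h₂.exists_down (t := t') (by omega)
      have := h₂.depth_edge hs
      exact ⟨(t, s), (edge _ _).2 (.inr ⟨rfl, hs, by simp only; omega⟩)⟩
    · obtain ⟨s, hs⟩ := h₁.exists_down (t := t) (by omega)
      have := h₁.rank_edge hs
      have := h₁.depth_edge hs
      exact ⟨(s, t'), (edge _ _).2 (.inl ⟨hs, rfl, by simp only; omega, by simp only; omega⟩)⟩

variable {R₁ R₂ : ColoredRankedPoset.{u, v} I}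

theorem IsFibrous.crystalProduct (h₁ : R₁.IsFibrous) (h₂ : R₂.IsFibrous) :
    (crystalProduct R₁ R₂).IsFibrous :=
  isFibrous_of_hasStrings fun i => ⟨_, _, (h₁.hasStrings i).crystalProduct (h₂.hasStrings i)⟩

theorem depthIn_crystalProduct (h₁ : R₁.IsFibrous) (h₂ : R₂.IsFibrous) (i : I) (x : R₁.V)
    (y : R₂.V) : (crystalProduct R₁ R₂).depthIn i (x, y) =
      R₁.depthIn i x + (R₂.depthIn i y - R₁.rankIn i x) := by
  rw [((h₁.hasStrings i).crystalProduct (h₂.hasStrings i)).depthIn_eq]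

theorem wt_crystalProduct (h₁ : R₁.IsFibrous) (h₂ : R₂.IsFibrous)
    (x : (crystalProduct R₁ R₂).V) :
    (crystalProduct R₁ R₂).wt x = R₁.wt x.1 + R₂.wt x.2 := by
  ext i
  rw [((h₁.hasStrings i).crystalProduct (h₂.hasStrings i)).wt_apply, Pi.add_apply,
    (h₁.hasStrings i).wt_apply, (h₂.hasStrings i).wt_apply]
  omega

theorem IsStructured.crystalProduct {A : Matrix I I ℤ} (h₁ : R₁.IsFibrous) (h₂ : R₂.IsFibrous)
    (hA₁ : R₁.IsStructured A) (hA₂ : R₂.IsStructured A) :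
    (crystalProduct R₁ R₂).IsStructured A := by
  intro i s t e
  rw [wt_crystalProduct h₁ h₂, wt_crystalProduct h₁ h₂]
  rcases e with ⟨e, e', -⟩ | ⟨e', e, -⟩
  · rw [e', ← hA₁ i _ _ e]
    abel
  · rw [e', ← hA₂ i _ _ e]
    abel

variable {U : Set R.V}

theorem HasStrings.restrict (hU : R.IsUnionOfComponents U) (h : R.HasStrings i r d) :
    (R.restrict U).HasStrings i (fun x => r x.1) (fun x => d x.1) where
  right_unique e e' := Subtype.ext (h.right_unique e e')
  left_unique e e' := Subtype.ext (h.left_unique e e')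
  rank_edge e := h.rank_edge e
  depth_edge e := h.depth_edge e
  exists_up {s} hs := by
    obtain ⟨t, ht⟩ := h.exists_up hs
    exact ⟨⟨t, hU _ s.2 (.rel _ _ ⟨i, trivial, ht⟩)⟩, ht⟩
  exists_down {t} ht := by
    obtain ⟨s, hs⟩ := h.exists_down ht
    exact ⟨⟨s, hU _ t.2 (.symm _ _ (.rel _ _ ⟨i, trivial, hs⟩))⟩, hs⟩

theorem IsFibrous.restrict (hU : R.IsUnionOfComponents U) (h : R.IsFibrous) :
    (R.restrict U).IsFibrous :=
  isFibrous_of_hasStrings fun i => ⟨_, _, (h.hasStrings i).restrict hU⟩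

theorem depthIn_restrict (hU : R.IsUnionOfComponents U) (h : R.IsFibrous) (i : I)
    (x : (R.restrict U).V) : (R.restrict U).depthIn i x = R.depthIn i x.1 := by
  rw [((h.hasStrings i).restrict hU).depthIn_eq]

theorem wt_restrict (hU : R.IsUnionOfComponents U) (h : R.IsFibrous) (x : (R.restrict U).V) :
    (R.restrict U).wt x = R.wt x.1 := by
  ext i
  rw [((h.hasStrings i).restrict hU).wt_apply, (h.hasStrings i).wt_apply]

theorem IsStructured.restrict {A : Matrix I I ℤ} (hU : R.IsUnionOfComponents U)
    (h : R.IsFibrous) (hA : R.IsStructured A) : (R.restrict U).IsStructured A := by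
  intro i s t e
  rw [wt_restrict hU h, wt_restrict hU h]
  exact hA i _ _ e

/-! ### Violation colorings -/

variable {J : Finset I} {ν : J → ℤ}

/-- A choice, for each vertex `x` outside `ℳ_{J,ν}(R)`, of a color `j ∈ J` with `δⱼ(x) > νⱼ`, such
that a vertex of color `j` shares its color with the whole part `δⱼ > νⱼ` of its string of color
`j`. The vertices in `ℳ_{J,ν}(R)` get the value `none`. -/
structure IsViolationColoring (R : ColoredRankedPoset.{u, v} I) {J : Finset I} (ν : J → ℤ)
    (c : R.V → Option J) : Prop where
  eq_none_iff : ∀ x, c x = none ↔ x ∈ R.maxSet J ν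
  lt_depthIn : ∀ x j, c x = some j → ν j < R.depthIn j x
  edge : ∀ s t (j : J), R.Edge j s t → ν j < R.depthIn j t → (c s = some j ↔ c t = some j)

theorem IsViolationColoring.eqvGen {c : R.V → Option J} (hc : R.IsViolationColoring ν c)
    (h : R.IsFibrous) {j : J} {x y : R.V} (hxy : EqvGen (R.Edge j) x y) (hx : c x = some j)
    (hy : ν j < R.depthIn j y) : c y = some j := by
  have hs := h.hasStrings (j : I)
  have key {s t : R.V} (hst : ReflTransGen (R.Edge j) s t) :
      ν j < R.depthIn j t → (c s = some j ↔ c t = some j) := by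
    induction hst with
    | refl => exact fun _ => .rfl
    | tail _ e ih =>
      intro ht
      have := hs.depth_edge e
      exact (ih (by omega)).trans (hc.edge _ _ j e ht)
  rcases hs.comparable hxy with e | e
  · exact (key e hy).1 hx
  · exact (key e (hc.lt_depthIn x j hx)).2 hx

/-- The color is taken from a violation on a string of length at least two if there is one, in which
case it is unique. The part `δⱼ > νⱼ` of a string of length at most one has at most one vertex, so
that other choices are harmless. -/
theorem IsPrimary.exists_isViolationColoring (h : R.IsPrimary) (hν : IsDominant ν) :
    ∃ c, R.IsViolationColoring ν c := by
  classical
  obtain ⟨hf, hp⟩ := h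
  let V (x : R.V) (j : J) : Prop := ν j < R.depthIn j x
  let c (x : R.V) : Option J :=
    if h : ∃ j : J, V x j ∧ 2 ≤ R.lengthIn j x then some h.choose
    else if h : ∃ j : J, V x j then some h.choose else none
  have long {x : R.V} {j : J} (hj : V x j) (hl : 2 ≤ R.lengthIn j x) : c x = some j := by
    have hex : ∃ j : J, V x j ∧ 2 ≤ R.lengthIn j x := ⟨j, hj, hl⟩
    simp only [c, dif_pos hex]
    obtain ⟨h1, h2⟩ := hex.choose_spec
    by_contra hne
    have hne' : (hex.choose : I) ≠ j := fun e => hne (congrArg _ (Subtype.ext e))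
    have h3 := hν j
    have h4 := hν hex.choose
    simp only [V] at hj h1
    have := hp j hex.choose x hne' hl (by omega) h2
    omega
  refine ⟨c, fun x => ?_, fun x j hj => ?_, fun s t j e hj => ?_⟩
  · by_cases h1 : ∃ j : J, V x j ∧ 2 ≤ R.lengthIn j x
    · obtain ⟨j, hj, hl⟩ := h1
      simp only [long hj hl, reduceCtorEq, false_iff]
      exact fun hx => absurd (hx j) (not_le.2 hj)
    · by_cases h2 : ∃ j : J, V x j
      · simp only [c, dif_neg h1, dif_pos h2, reduceCtorEq, false_iff]
        obtain ⟨j, hj⟩ := h2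
        exact fun hx => absurd (hx j) (not_le.2 hj)
      · simp only [c, dif_neg h1, dif_neg h2, true_iff]
        push Not at h2
        exact fun j => not_lt.1 (h2 j)
  · by_cases h1 : ∃ j : J, V x j ∧ 2 ≤ R.lengthIn j x
    · simp only [c, dif_pos h1, Option.some.injEq] at hj
      exact hj ▸ h1.choose_spec.1
    · by_cases h2 : ∃ j : J, V x j
      · simp only [c, dif_neg h1, dif_pos h2, Option.some.injEq] at hj
        exact hj ▸ h2.choose_spec
      · simp only [c, dif_neg h1, dif_neg h2, reduceCtorEq] at hj
  · -- both ends of the edge have depth above `νⱼ ≥ 0`, so that the string has length at least two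
    have hs := hf.hasStrings (j : I)
    have h1 := hs.depth_edge e
    have h2 := hs.rank_edge e
    have h3 := hν j
    have ht := long (x := t) (j := j) hj (by rw [hs.lengthIn_eq]; omega)
    have hs' := long (x := s) (j := j) (by simp only [V]; omega) (by rw [hs.lengthIn_eq]; omega)
    simp [ht, hs']

theorem isDominant_of_mem_maxSet (h : R.IsFibrous) {x : R.V} (hx : x ∈ R.maxSet J ν) :
    IsDominant (ν + R.wtRes J x) := by
  intro j
  have h1 := hx j
  have h2 := (h.hasStrings (j : I)).wt_apply x
  have h3 : R.wtRes J x j = R.wt x j := rfl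
  rw [Pi.add_apply, h3, h2]
  omega

/-- The color of `(x₁, x₂)` is that of `x₁` if there is one, and otherwise that of `x₂` with respect to
the weight `ν + wt^J(x₁)`, which is dominant in this case. -/
theorem IsViolationColoring.crystalProduct (h₁ : R₁.IsFibrous) {c₁ : R₁.V → Option J}
    (hc₁ : R₁.IsViolationColoring ν c₁) (h₂ : R₂.IsPrimary) :
    ∃ c, (crystalProduct R₁ R₂).IsViolationColoring ν c := by
  classical
  have key (x : R₁.V) : ∃ c₂ : R₂.V → Option J, x ∈ R₁.maxSet J ν →
      R₂.IsViolationColoring (ν + R₁.wtRes J x) c₂ := by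
    by_cases hx : x ∈ R₁.maxSet J ν
    · obtain ⟨c, hc⟩ := h₂.exists_isViolationColoring (isDominant_of_mem_maxSet h₁ hx)
      exact ⟨c, fun _ => hc⟩
    · exact ⟨fun _ => none, fun h => absurd h hx⟩
  choose c₂ hc₂ using key
  have hwt (x : R₁.V) (j : J) :
      (ν + R₁.wtRes J x) j = ν j + (R₁.rankIn j x - R₁.depthIn j x) := by
    rw [← (h₁.hasStrings (j : I)).wt_apply x]
    rfl
  refine ⟨fun x => (c₁ x.1).or (c₂ x.1 x.2), ?_, ?_, ?_⟩
  · rintro ⟨x, y⟩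
    simp only [Option.or_eq_none_iff, hc₁.eq_none_iff]
    constructor
    · rintro ⟨hx, hy⟩ j
      rw [(hc₂ x hx).eq_none_iff] at hy
      have h3 := hx j
      have h4 := hy j
      rw [hwt] at h4
      rw [depthIn_crystalProduct h₁ h₂.1]
      omega
    · intro hxy
      have hx : x ∈ R₁.maxSet J ν := fun j => by
        have := hxy j
        rw [depthIn_crystalProduct h₁ h₂.1] at this
        omega
      refine ⟨hx, ((hc₂ x hx).eq_none_iff _).2 fun j => ?_⟩
      have := hxy j
      rw [depthIn_crystalProduct h₁ h₂.1] at this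
      rw [hwt]
      omega
  · rintro ⟨x, y⟩ j hj
    rw [depthIn_crystalProduct h₁ h₂.1]
    simp only [Option.or_eq_some_iff] at hj
    rcases hj with hj | ⟨hx, hj⟩
    · have := hc₁.lt_depthIn x j hj
      omega
    · have := (hc₂ x ((hc₁.eq_none_iff x).1 hx)).lt_depthIn y j hj
      rw [hwt] at this
      omega
  · rintro ⟨x, y⟩ ⟨x', y'⟩ j e hj
    rw [depthIn_crystalProduct h₁ h₂.1] at hj
    rcases e with ⟨e, e', h3, -⟩ | ⟨e', e, h3⟩ <;> simp only at e e' h3 hj ⊢ <;> subst e'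
    · have h4 := (h₁.hasStrings (j : I)).rank_edge e
      have h5 := (h₁.hasStrings (j : I)).depth_edge e
      have hlt : ν j < R₁.depthIn j x' := by omega
      -- the color `j` cannot come from the second factor, as `δⱼ` violates the bound on the first
      have first {z : R₁.V} (hz : ν j < R₁.depthIn j z) :
          (c₁ z).or (c₂ z y) = some j ↔ c₁ z = some j := by
        rw [Option.or_eq_some_iff, or_iff_left]
        rintro ⟨hn, -⟩
        exact absurd ((hc₁.eq_none_iff z).1 hn j) (not_le.2 hz)
      rw [first hlt, first (by omega)]
      exact hc₁.edge x x' j e hlt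
    · -- the first factor does not move
      rcases hx : c₁ x with _ | k
      · simp only [Option.none_or]
        refine (hc₂ x ((hc₁.eq_none_iff x).1 hx)).edge y y' j e ?_
        have h5 := (h₂.1.hasStrings (j : I)).depth_edge e
        have h6 := (hc₁.eq_none_iff x).1 hx j
        rw [hwt]
        omega
      · simp

theorem IsViolationColoring.restrict (hU : R.IsUnionOfComponents U) (h : R.IsFibrous)
    {c : R.V → Option J} (hc : R.IsViolationColoring ν c) :
    (R.restrict U).IsViolationColoring ν fun x => c x.1 where
  eq_none_iff x := by
    rw [hc.eq_none_iff]
    exact forall_congr' fun j => by rw [depthIn_restrict hU h]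
  lt_depthIn x j hj := by
    rw [depthIn_restrict hU h]
    exact hc.lt_depthIn _ j hj
  edge s t j e hj := by
    rw [depthIn_restrict hU h] at hj
    exact hc.edge _ _ j e hj

end ColoredRankedPoset

/-! ### Alternants -/

namespace WeylChar

section

variable {ι M N : Type*} [Finite ι] [AddCommGroup M] [Module ℝ M] [AddCommGroup N] [Module ℝ N]
  {P : RootPairing ι ℝ M N} [P.IsRootSystem] [P.IsCrystallographic] (b : P.Base)
  (J : Finset b.support)

theorem det_simpleRefl (j : J) : LinearEquiv.det (simpleRefl b J j) = -1 := by
  have h : (simpleRefl b J j : (J → ℤ) →ₗ[ℤ] (J → ℤ)) =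
      LinearMap.transvection (LinearMap.proj j) (-subCartan b.cartanMatrix J j) := by
    refine LinearMap.ext fun μ => ?_
    rw [LinearMap.transvection.apply, smul_neg, ← sub_eq_add_neg]
    exact simpleRefl_apply b J j μ
  ext
  rw [LinearEquiv.coe_det, h, LinearMap.transvection.det]
  simp

theorem simpleRefl_mem_weylGroup (j : J) :
    simpleRefl b J j ∈ weylGroup (subCartan b.cartanMatrix J) :=
  Subgroup.subset_closure ⟨j, simpleRefl_apply b J j⟩

/-- Alternants are antisymmetric. -/
theorem alternant_simpleRefl (j : J) (μ : J → ℤ) :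
    alternant (subCartan b.cartanMatrix J) (simpleRefl b J j μ) =
      -alternant (subCartan b.cartanMatrix J) μ := by
  rw [alternant, alternant, ← finsum_neg_distrib]
  conv_rhs => rw [← finsum_comp_equiv (Equiv.mulRight ⟨_, simpleRefl_mem_weylGroup b J j⟩)]
  refine finsum_congr fun w => ?_
  simp [det_simpleRefl]

/-- A sum of exponentials invariant under the simple reflections is invariant under `W_J`. -/
theorem sum_expo_apply {X : Type*} [Fintype X] {f : X → J → ℤ}
    (hf : ∀ j, ∃ e : X ≃ X, ∀ x, f (e x) = simpleRefl b J j (f x))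
    {w : (J → ℤ) ≃ₗ[ℤ] (J → ℤ)} (hw : w ∈ weylGroup (subCartan b.cartanMatrix J)) :
    ∑ x, expo (w (f x)) = ∑ x, expo (f x) := by
  obtain ⟨L, rfl⟩ := exists_word b J hw
  clear hw
  induction L using List.reverseRecOn with
  | nil => simp
  | append_singleton L j ih =>
    obtain ⟨e, he⟩ := hf j
    rw [← ih, eq_comm, ← e.sum_comp]
    simp [he]

/-- Multiplying an alternant by a `W_J`-invariant sum of exponentials. -/
theorem alternant_mul_sum_expo {X : Type*} [Fintype X] {f : X → J → ℤ}
    (hf : ∀ j, ∃ e : X ≃ X, ∀ x, f (e x) = simpleRefl b J j (f x)) (μ : J → ℤ) :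
    alternant (subCartan b.cartanMatrix J) μ * ∑ x, expo (f x) =
      ∑ x, alternant (subCartan b.cartanMatrix J) (μ + f x) := by
  have := weylGroup_finite b J
  have := Fintype.ofFinite (weylGroup (subCartan b.cartanMatrix J))
  simp only [alternant, finsum_eq_sum_of_fintype]
  rw [Finset.sum_comm, Finset.sum_mul]
  refine Finset.sum_congr rfl fun w _ => ?_
  rw [← sum_expo_apply b J hf w.2, Finset.mul_sum]
  refine Finset.sum_congr rfl fun x _ => ?_
  rw [smul_mul_assoc, AddMonoidAlgebra.single_mul_single, one_mul, map_add]

end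

end WeylChar

/-! ### Splitting -/

namespace ColoredRankedPoset

open WeylChar Relation

section

variable {I : Type v} {R : ColoredRankedPoset.{u, v} I} {A : Matrix I I ℤ} {J : Finset I}

theorem IsStructured.wtRes_eq (hA : R.IsStructured A) (h : R.IsFibrous) {j : J}
    {x y : R.V} (hxy : EqvGen (R.Edge j) x y) :
    R.wtRes J y = R.wtRes J x +
      ((R.depthIn j x : ℤ) - R.depthIn j y) • subCartan A J j := by
  rw [wtRes, hA.wt_eq (h.hasStrings (j : I)) hxy]
  rfl

theorem IsFibrous.wtRes_apply (h : R.IsFibrous) (x : R.V) (j : J) :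
    R.wtRes J x j = R.rankIn j x - R.depthIn j x :=
  (h.hasStrings (j : I)).wt_apply x

theorem restrictChar_wgf [Fintype R.V] : restrictChar J R.wgf = ∑ x, expo (R.wtRes J x) := by
  rw [wgf, finsum_eq_sum_of_fintype, restrictChar, ← AddMonoidAlgebra.mapDomainRingHom_apply,
    map_sum]
  simp [wtRes]

end

variable {ι M N : Type*} [Finite ι] [AddCommGroup M] [Module ℝ M] [AddCommGroup N] [Module ℝ N]
  {P : RootPairing ι ℝ M N} [P.IsRootSystem] [P.IsCrystallographic] {b : P.Base}
  {R : ColoredRankedPoset.{u} b.support} {J : Finset b.support} {ν : J → ℤ}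

/-- Turning all strings of color `j` upside down realizes the simple reflection `sⱼ` on the
weights of `R`. -/
theorem IsStructured.exists_equiv (hA : R.IsStructured b.cartanMatrix) (h : R.IsFibrous) (j : J) :
    ∃ e : R.V ≃ R.V, ∀ x, R.wtRes J (e x) = simpleRefl b J j (R.wtRes J x) := by
  have hs := h.hasStrings (j : b.support)
  choose e he hd using fun x => hs.exists_depth x (Nat.le_add_right (R.rankIn j x) _)
  have hinv : Function.Involutive e := fun x => by
    refine (hs.eq_of_depth ((he x).trans _ _ _ (he (e x))) ?_).symm
    have := (hs.invariants (he x)).1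
    have := hd x
    rw [hd]
    omega
  refine ⟨hinv.toPerm, fun x => ?_⟩
  rw [Function.Involutive.coe_toPerm, hA.wtRes_eq h (he x), simpleRefl_apply, h.wtRes_apply, hd]
  module

/-- The alternants of the vertices outside `ℳ_{J,ν}(R)` cancel. -/
theorem IsViolationColoring.sum_alternant_eq_zero {c : R.V → Option J}
    (hc : R.IsViolationColoring ν c) (hA : R.IsStructured b.cartanMatrix) (h : R.IsFibrous)
    (hν : IsDominant ν) {s : Finset R.V} (hmem : ∀ x, x ∈ s ↔ x ∉ R.maxSet J ν) :
    ∑ x ∈ s, alternant (subCartan b.cartanMatrix J) (ν + R.wtRes J x + rho J) = 0 := by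
  -- The partner of `x` is the vertex of its string whose weight, shifted by `ν + ϱ`, is the
  -- mirror image under `sⱼ`, where `j` is the color of `x`.
  have key (x : R.V) (hx : x ∈ s) : ∃ (j : J) (y : R.V), c x = some j ∧ EqvGen (R.Edge j) x y ∧
      (R.depthIn j y : ℤ) = R.rankIn j x + ν j + 1 := by
    rcases hj : c x with _ | j
    · exact absurd ((hc.eq_none_iff x).1 hj) ((hmem x).1 hx)
    · have h1 := hc.lt_depthIn x j hj
      have h2 := hν j
      obtain ⟨y, hy, e⟩ := (h.hasStrings (j : b.support)).exists_depth x
        (n := R.rankIn j x + (ν j).toNat + 1) (by omega)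
      exact ⟨j, y, rfl, hy, by omega⟩
  choose j g hj hg hd using key
  have hcg (x : R.V) (hx : x ∈ s) : c (g x hx) = some (j x hx) :=
    hc.eqvGen h (hg x hx) (hj x hx) (by have := hd x hx; omega)
  have hgs (x : R.V) (hx : x ∈ s) : g x hx ∈ s := by
    rw [hmem, ← hc.eq_none_iff, hcg]
    simp
  have hneg (x : R.V) (hx : x ∈ s) :
      alternant (subCartan b.cartanMatrix J) (ν + R.wtRes J (g x hx) + rho J) =
        -alternant (subCartan b.cartanMatrix J) (ν + R.wtRes J x + rho J) := by
    rw [← alternant_simpleRefl b J (j x hx), simpleRefl_apply, hA.wtRes_eq h (hg x hx), hd x hx]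
    simp only [Pi.add_apply, h.wtRes_apply, rho]
    congr 1
    module
  refine Finset.sum_involution g (fun x hx => by rw [hneg, add_neg_cancel]) (fun x hx hne e => ?_)
    hgs (fun x hx => ?_)
  · -- the weight of a fixed vertex lies on the mirror, and its alternant is its own negative
    have := hneg x hx
    rw [e] at this
    refine hne (AddMonoidAlgebra.ext (Finsupp.ext fun μ => ?_))
    have h0 := congrArg (fun a => a.coeff μ) this
    simp only [AddMonoidAlgebra.coeff_neg, Finsupp.neg_apply, AddMonoidAlgebra.coeff_zero,
      Finsupp.zero_apply] at h0 ⊢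
    omega
  · have e : j (g x hx) (hgs x hx) = j x hx :=
      Option.some.inj ((hj _ _).symm.trans (hcg x hx))
    have h1 := hg (g x hx) (hgs x hx)
    have h2 := hd (g x hx) (hgs x hx)
    rw [e] at h1 h2
    have hs := h.hasStrings (j x hx : b.support)
    refine (hs.eq_of_depth ((hg x hx).trans _ _ _ h1) ?_).symm
    have := (hs.invariants (hg x hx)).1
    have := hd x hx
    omega

/-- A violation coloring makes `R` a `(J,ν)`-splitting poset. -/
theorem IsViolationColoring.isSplitting {c : R.V → Option J} (hc : R.IsViolationColoring ν c)
    (hA : R.IsStructured b.cartanMatrix) (h : R.IsFibrous) (hν : IsDominant ν) :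
    R.IsSplitting b.cartanMatrix J ν (R.maxSet J ν) := by
  classical
  refine ⟨hA, fun x hx => isDominant_of_mem_maxSet h hx, ?_⟩
  have := Fintype.ofFinite R.V
  rw [finsum_mem_eq_toFinset_sum, restrictChar_wgf]
  simp only [bialternant]
  rw [← Finset.sum_div, div_mul_eq_mul_div, ← map_mul, ← map_sum,
    alternant_mul_sum_expo b J (hA.exists_equiv h)]
  congr 2
  rw [← Finset.sum_add_sum_compl (R.maxSet J ν).toFinset]
  simp only [add_right_comm ν (rho J)]
  rw [hc.sum_alternant_eq_zero hA h hν (s := (R.maxSet J ν).toFinsetᶜ) (by simp), add_zero]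

end ColoredRankedPoset

/-- The properties used in the cancellation pass from the factors to an iterated product. -/
theorem ColoredRankedPoset.crystalProductList_spec {I : Type v} {A : Matrix I I ℤ}
    (R₁ : ColoredRankedPoset.{u, v} I) (Rs : List (ColoredRankedPoset.{u, v} I))
    (h₁ : R₁.IsFibrous) (hA₁ : R₁.IsStructured A)
    (hc₁ : ∀ (J : Finset I) (ν : J → ℤ), WeylChar.IsDominant ν → ∃ c, R₁.IsViolationColoring ν c)
    (hR : ∀ Q ∈ Rs, Q.IsStructured A ∧ Q.IsPrimary) :
    (crystalProductList R₁ Rs).IsFibrous ∧ (crystalProductList R₁ Rs).IsStructured A ∧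
      ∀ (J : Finset I) (ν : J → ℤ), WeylChar.IsDominant ν →
        ∃ c, (crystalProductList R₁ Rs).IsViolationColoring ν c := by
  induction Rs generalizing R₁ with
  | nil => exact ⟨h₁, hA₁, hc₁⟩
  | cons Q Rs ih =>
    obtain ⟨hAQ, hQ⟩ := hR Q (by simp)
    refine ih (crystalProduct R₁ Q) (h₁.crystalProduct hQ.1) (hA₁.crystalProduct h₁ hQ.1 hAQ)
      (fun J ν hν => ?_) fun Q' hQ' => hR Q' (by simp [hQ'])
    obtain ⟨c, hc⟩ := hc₁ J ν hν
    exact hc.crystalProduct h₁ hQ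

end

theorem theorem6p5 {ι M N : Type*} [Finite ι] [AddCommGroup M] [Module ℝ M]
    [AddCommGroup N] [Module ℝ N] (P : RootPairing ι ℝ M N) [P.IsRootSystem]
    [P.IsCrystallographic] [P.IsReduced] (b : P.Base)
    (R₁ : ColoredRankedPoset b.support) (Rs : List (ColoredRankedPoset b.support))
    (hR : ∀ Q ∈ R₁ :: Rs, Q.IsStructured b.cartanMatrix ∧ Q.IsPrimary)
    (U : Set (ColoredRankedPoset.crystalProductList R₁ Rs).V)
    (hU : (ColoredRankedPoset.crystalProductList R₁ Rs).IsUnionOfComponents U) :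
    ((ColoredRankedPoset.crystalProductList R₁ Rs).restrict U).IsCrystallineSplitting
        b.cartanMatrix ∧
      ∀ (J : Finset b.support) (ν : J → ℤ), WeylChar.IsDominant ν →
        ((ColoredRankedPoset.crystalProductList R₁ Rs).restrict U).IsSplitting b.cartanMatrix J ν
          (((ColoredRankedPoset.crystalProductList R₁ Rs).restrict U).maxSet J ν) := by
  obtain ⟨hA₁, h₁⟩ := hR R₁ (by simp)
  obtain ⟨hf, hA, hc⟩ := ColoredRankedPoset.crystalProductList_spec R₁ Rs h₁.1 hA₁
    (fun J ν hν => h₁.exists_isViolationColoring hν) fun Q hQ => hR Q (by simp [hQ])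
  have hfU := hf.restrict hU
  have hAU := hA.restrict hU hf
  have key (J : Finset b.support) (ν : J → ℤ) (hν : WeylChar.IsDominant ν) :
      ((ColoredRankedPoset.crystalProductList R₁ Rs).restrict U).IsSplitting b.cartanMatrix J ν
        (((ColoredRankedPoset.crystalProductList R₁ Rs).restrict U).maxSet J ν) := by
    obtain ⟨c, hc⟩ := hc J ν hν
    exact (hc.restrict hU hf).isSplitting hAU hfU hν
  exact ⟨⟨hAU, hfU, fun J ν hν => ⟨_, key J ν hν⟩⟩, key⟩
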